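/- Let $K$ be an algebraically closed field of arbitrary characteristic, let $n\ge 2$ and $\ell\ge 1$ be integers, and let $\underline x=(x_1,\dots,x_n)$ and $\underline\lambda=(\lambda_1,\dots,\lambda_\ell)$ be tuples of independent variables over $K$. Let $P,Q_1,\dots,Q_\ell\in K[\underline x]$ be non-zero polynomials, pairwise distinct up to multiplicative constants, not all constant, and relatively prime (every common divisor of all of them is a constant). Put $$F(\underline x,\underline\lambda)=P(\underline x)+\lambda_1Q_1(\underline x)+\cdots+\lambda_\ell Q_\ell(\underline x).$$ **Definitions.** Let $\phi,\psi\in K[\underline x]$ be relatively prime with $\max(\deg\phi,\deg\psi)<\deg_{\underline x}F$. A *$(\phi,\psi)$-homogeneous decomposition* of $F$ is an identity $F(\underline x,\underline\lambda)=H(\phi(\underline x),\psi(\underline x),\underline\lambda)$, where $H(u,v,\underline\lambda)\in\overline{K(\underline\lambda)}[u,v]$ is homogeneous in $(u,v)$. It is *maximal* if $\phi+t\psi$ is irreducible in $\overline{K(t)}[\underline x]$, where $t$ is a new variable. It is *reduced* if $H$ has no linear factor $\alpha u+\beta v$ with $(\alpha,\beta)\in K^2\setminus\{(0,0)\}$ such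 that $\alpha\phi+\beta\psi$ is constant. **Theorem.** Suppose that $F$ admits two maximal homogeneous decompositions $$F(\underline x,\underline\lambda)=H_1(\phi_1(\underline x),\psi_1(\underline x),\underline\lambda)=H_2(\phi_2(\underline x),\psi_2(\underline x),\underline\lambda).$$ Then there exists $L\in\mathrm{GL}_2(K)$ such that $(\phi_1,\psi_1)=L(\phi_2,\psi_2)$. Furthermore, if the two decompositions are reduced, then for this $L$ we have $c\cdot H_2(u,v,\underline\lambda)=H_1(L(u,v),\underline\lambda)$ for some non-zero constant $c\in K$. -/

import Mathlib

open MvPolynomial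

noncomputable section

/-- The field `K(λ₁, …, λ_ℓ)` of rational functions in `ℓ` independent variables. -/
abbrev ParamField (K : Type*) [Field K] (ℓ : ℕ) : Type _ :=
  FractionRing (MvPolynomial (Fin ℓ) K)

/-- An algebraic closure of `K(λ₁, …, λ_ℓ)`. -/
abbrev ParamClosure (K : Type*) [Field K] (ℓ : ℕ) : Type _ :=
  AlgebraicClosure (ParamField K ℓ)

/-- The polynomial `F(x, λ) = P(x) + λ₁ Q₁(x) + ⋯ + λ_ℓ Q_ℓ(x)`, as a polynomial in
`x₁, …, xₙ` whose coefficients are polynomials in `λ₁, …, λ_ℓ` over `K`. Its total degree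
is the degree of `F` in `x`. -/
def genericForm {K : Type*} [Field K] {n ℓ : ℕ}
    (P : MvPolynomial (Fin n) K) (Q : Fin ℓ → MvPolynomial (Fin n) K) :
    MvPolynomial (Fin n) (MvPolynomial (Fin ℓ) K) :=
  map C P + ∑ i, C (X i) * map C (Q i)

/-- `F = H(φ, ψ, λ)` is a `(φ, ψ)`-homogeneous decomposition of `F`: the polynomials
`φ, ψ ∈ K[x]` are relatively prime, of degrees smaller than the degree of `F` in `x`, the
polynomial `H` in `u = X 0` and `v = X 1` with coefficients in the algebraic closure of `K(λ)`
is homogeneous, and `F(x, λ) = H(φ(x), ψ(x), λ)`. -/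
structure IsHomogeneousDecomposition {K : Type*} [Field K] {n ℓ : ℕ}
    (F : MvPolynomial (Fin n) (MvPolynomial (Fin ℓ) K))
    (φ ψ : MvPolynomial (Fin n) K) (H : MvPolynomial (Fin 2) (ParamClosure K ℓ)) : Prop where
  isRelPrime : IsRelPrime φ ψ
  degree_lt : max φ.totalDegree ψ.totalDegree < F.totalDegree
  isHomogeneous : ∃ d : ℕ, H.IsHomogeneous d
  eq_comp : map (algebraMap (MvPolynomial (Fin ℓ) K) (ParamClosure K ℓ)) F =
    aeval ![map (algebraMap K (ParamClosure K ℓ)) φ, map (algebraMap K (ParamClosure K ℓ)) ψ] H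

/-- A `(φ, ψ)`-homogeneous decomposition of `F` is maximal if, for a new single variable `t`,
the polynomial `φ + t ψ` is irreducible over the algebraic closure of `K(t)`. -/
structure IsMaximalDecomposition {K : Type*} [Field K] {n ℓ : ℕ}
    (F : MvPolynomial (Fin n) (MvPolynomial (Fin ℓ) K))
    (φ ψ : MvPolynomial (Fin n) K) (H : MvPolynomial (Fin 2) (ParamClosure K ℓ)) : Prop
    extends IsHomogeneousDecomposition F φ ψ H where
  irreducible : Irreducible
    (map (algebraMap K (AlgebraicClosure (RatFunc K))) φ +
      C (algebraMap (RatFunc K) (AlgebraicClosure (RatFunc K)) RatFunc.X) *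
        map (algebraMap K (AlgebraicClosure (RatFunc K))) ψ)

/-- A decomposition `F = H(φ, ψ, λ)` is reduced if `H` has no linear factor `α u + β v`, with
`α, β ∈ K` not both zero, such that `α φ + β ψ` is constant. -/
def IsReducedDecomposition {K : Type*} [Field K] {n ℓ : ℕ}
    (φ ψ : MvPolynomial (Fin n) K) (H : MvPolynomial (Fin 2) (ParamClosure K ℓ)) : Prop :=
  ∀ α β : K, (α, β) ≠ (0, 0) →
    C (algebraMap K (ParamClosure K ℓ) α) * X 0 + C (algebraMap K (ParamClosure K ℓ) β) * X 1 ∣ H →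
    ¬ ∃ c : K, C α * φ + C β * ψ = C c

end

/-! ### Irreducibility over an algebraically closed field is geometric -/

/-! Let `L` be the algebraic closure of `K(λ)`. Over `L` each form `Hᵢ` splits into linear forms, so
`F` is, up to a scalar, a product of members `x φᵢ + y ψᵢ` of a pencil. If `y / x` lies in `K ∪
{∞}`, the member is a scalar times a polynomial over `K` dividing `F`, hence constant, since `P, Q₁,
…, Q_ℓ` are coprime (`isUnit_of_map_dvd_genericForm`). Otherwise `y / x` is transcendental over `K`,
and maximality makes the member irreducible (`irreducible_pencil`).

So the nonconstant members are the prime factors of `F` in both decompositions. Matching one pair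
gives `φ₁ + t ψ₁` as an `L`-combination of `φ₂, ψ₂` with `t ∉ K`; `K`-linear functionals on `L`
separating `1` from `t` yield the matrix over `K`. In the reduced case no factor is constant, so
`deg Hᵢ` counts the prime factors of `F`; the degrees agree, and a form vanishing at `(φ₂, ψ₂)` is
zero. -/

theorem exists_algHom_of_finiteType (k A : Type*) [Field k] [IsAlgClosed k] [CommRing A]
    [Nontrivial A] [Algebra k A] [Algebra.FiniteType k A] : Nonempty (A →ₐ[k] k) := by
  obtain ⟨M, hM⟩ := Ideal.exists_maximal A
  let _ : Field (A ⧸ M) := Ideal.Quotient.field M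
  have : Module.Finite k (A ⧸ M) := finite_of_finite_type_of_isJacobsonRing k (A ⧸ M)
  have hb : Function.Bijective (Algebra.ofId k (A ⧸ M)) :=
    IsAlgClosed.algebraMap_bijective_of_isIntegral
  exact ⟨(AlgEquiv.ofBijective _ hb).symm.toAlgHom.comp (Ideal.Quotient.mkₐ k M)⟩

theorem MvPolynomial.isUnit_iff_forall_coeff_eq_zero {σ k : Type*} [Field k]
    {f : MvPolynomial σ k} (hf : f ≠ 0) : IsUnit f ↔ ∀ m ≠ 0, f.coeff m = 0 := by
  rw [MvPolynomial.isUnit_iff]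
  constructor
  · rintro ⟨-, h⟩ m hm
    simpa using h m hm
  · intro h
    refine ⟨?_, fun m hm => by simp [h m hm]⟩
    rw [isUnit_iff_ne_zero]
    intro h0
    apply hf
    ext m
    by_cases hm : m = 0
    · simp [hm, h0]
    · simp [h m hm]

/-- A factorisation over `L` is defined over a finitely generated `k`-algebra, and the weak
Nullstellensatz specialises it to `k`. -/
theorem MvPolynomial.irreducible_map_of_isAlgClosed {σ k L : Type*} [Field k]
    [IsAlgClosed k] [Field L] [Algebra k L] {f : MvPolynomial σ k} (hf : Irreducible f) :
    Irreducible (map (algebraMap k L) f) := by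
  have hinj : Function.Injective (map (σ := σ) (algebraMap k L)) :=
    map_injective _ (algebraMap k L).injective
  have hf0 : map (algebraMap k L) f ≠ 0 := by
    rw [Ne, map_eq_zero_iff _ hinj]
    exact hf.ne_zero
  constructor
  · intro hu
    apply hf.not_isUnit
    rw [MvPolynomial.isUnit_iff_forall_coeff_eq_zero hf0] at hu
    rw [MvPolynomial.isUnit_iff_forall_coeff_eq_zero hf.ne_zero]
    intro m hm
    simpa [coeff_map] using hu m hm
  · intro g h hgh
    by_contra! hcon
    obtain ⟨hg, hh⟩ := hcon
    have hg0 : g ≠ 0 := by rintro rfl; simp [hgh] at hf0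
    have hh0 : h ≠ 0 := by rintro rfl; simp [hgh] at hf0
    rw [MvPolynomial.isUnit_iff_forall_coeff_eq_zero hg0] at hg
    rw [MvPolynomial.isUnit_iff_forall_coeff_eq_zero hh0] at hh
    push Not at hg hh
    obtain ⟨i, hi, hgi⟩ := hg
    obtain ⟨j, hj, hhj⟩ := hh
    classical
    -- Adjoining inverses of one nonconstant coefficient of each factor keeps both factors
    -- nonconstant after specialisation.
    let s : Finset L := g.support.image g.coeff ∪ h.support.image h.coeff ∪
      {(g.coeff i)⁻¹, (h.coeff j)⁻¹}
    let A := Algebra.adjoin k (s : Set L)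
    have : Algebra.FiniteType k A :=
      (Subalgebra.fg_iff_finiteType A).1 ⟨s, rfl⟩
    obtain ⟨ρ⟩ := exists_algHom_of_finiteType k A
    have hsub : ∀ x ∈ s, x ∈ A := fun x hx => Algebra.subset_adjoin hx
    have lift : ∀ q : MvPolynomial σ L, (∀ m ∈ q.support, q.coeff m ∈ A) →
        ∃ q' : MvPolynomial σ A, map (algebraMap A L) q' = q := by
      intro q hq
      refine MvPolynomial.mem_range_map_iff_coeffs_subset.2 ?_
      intro x hx
      obtain ⟨m, hm, rfl⟩ := mem_coeffs_iff.1 hx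
      exact ⟨⟨_, hq m hm⟩, rfl⟩
    obtain ⟨g', hg'⟩ := lift g fun m hm => hsub _ (by
      simp only [s, Finset.mem_union, Finset.mem_image]; exact .inl (.inl ⟨m, hm, rfl⟩))
    obtain ⟨h', hh'⟩ := lift h fun m hm => hsub _ (by
      simp only [s, Finset.mem_union, Finset.mem_image]; exact .inl (.inr ⟨m, hm, rfl⟩))
    have hfac : map (algebraMap k A) f = g' * h' := by
      apply map_injective (algebraMap A L) (FaithfulSMul.algebraMap_injective A L)
      rw [map_map, map_mul, hg', hh', ← hgh]
      rfl
    have hfac' : f = map ρ.toRingHom g' * map ρ.toRingHom h' := by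
      rw [← map_mul, ← hfac, map_map]
      have : ρ.toRingHom.comp (algebraMap k A) = RingHom.id k := by
        ext x; simp
      rw [this, map_id]
    have key : ∀ (q' : MvPolynomial σ A) (m : σ →₀ ℕ), m ≠ 0 →
        (map (algebraMap A L) q').coeff m ≠ 0 → ((map (algebraMap A L) q').coeff m)⁻¹ ∈ A →
        ¬ IsUnit (map ρ.toRingHom q') := by
      intro q' m hm h0 hinv hu
      rw [coeff_map] at h0 hinv
      have hunit : IsUnit (q'.coeff m) := by
        refine IsUnit.of_mul_eq_one ⟨_, hinv⟩ ?_
        apply FaithfulSMul.algebraMap_injective A L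
        rw [map_mul, map_one]
        exact mul_inv_cancel₀ h0
      rw [MvPolynomial.isUnit_iff_forall_coeff_eq_zero hu.ne_zero] at hu
      have := hu m hm
      rw [coeff_map] at this
      exact (hunit.map ρ.toRingHom).ne_zero this
    rcases hf.isUnit_or_isUnit hfac' with hu | hu
    · exact key g' i hi (hg' ▸ hgi) (hg' ▸ hsub _ (by simp [s])) hu
    · exact key h' j hj (hh' ▸ hhj) (hh' ▸ hsub _ (by simp [s])) hu

/-! ### Binary forms over an algebraically closed field -/

/-- The binary linear form with coefficients `p.1` and `p.2`. -/
noncomputable def binaryLinearForm {L : Type*} [CommSemiring L] (p : L × L) :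
    MvPolynomial (Fin 2) L :=
  C p.1 * X 0 + C p.2 * X 1

theorem exists_homogenize_eq_prod {L : Type*} [Field L] [IsAlgClosed L] (n : ℕ)
    (p : Polynomial L) (hp : p ≠ 0) (hn : p.natDegree ≤ n) :
    ∃ (c : L) (s : Multiset (L × L)), c ≠ 0 ∧ s.card = n ∧ (∀ q ∈ s, q ≠ 0) ∧
      p.homogenize n = C c * (s.map binaryLinearForm).prod := by
  induction n generalizing p with
  | zero =>
    obtain ⟨c, rfl⟩ := Polynomial.natDegree_eq_zero.1 (Nat.le_zero.1 hn)
    refine ⟨c, 0, ?_, rfl, by simp, by simp⟩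
    rintro rfl
    simp at hp
  | succ n ih =>
    by_cases hd : p.natDegree ≤ n
    -- A degree drop is a root at infinity: it contributes the factor `v`.
    · obtain ⟨c, s, hc, hs, hs0, h⟩ := ih p hp hd
      refine ⟨c, (0, 1) ::ₘ s, hc, by simp [hs], by simpa using hs0, ?_⟩
      have := Polynomial.homogenize_mul p 1 hd (n := 1) (by simp)
      rw [mul_one] at this
      rw [this, h]
      simp [binaryLinearForm]
      ring
    · have hdeg : p.degree ≠ 0 := by
        intro h0
        rw [Polynomial.natDegree_eq_zero_iff_degree_le_zero.2 h0.le] at hd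
        exact hd n.zero_le
      obtain ⟨r, hr⟩ := IsAlgClosed.exists_root p hdeg
      obtain ⟨q, rfl⟩ := Polynomial.dvd_iff_isRoot.2 hr
      have hq : q ≠ 0 := right_ne_zero_of_mul hp
      have hX : (Polynomial.X - Polynomial.C r) ≠ 0 := left_ne_zero_of_mul hp
      rw [Polynomial.natDegree_mul hX hq, Polynomial.natDegree_X_sub_C] at hn
      obtain ⟨c, s, hc, hs, hs0, h⟩ := ih q hq (by omega)
      refine ⟨c, (1, -r) ::ₘ s, hc, by simp [hs], by simpa using hs0, ?_⟩
      rw [add_comm n 1, Polynomial.homogenize_mul _ _ (by simp) (by omega), h]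
      simp [binaryLinearForm]
      ring

theorem exists_eq_prod_of_isHomogeneous {L : Type*} [Field L] [IsAlgClosed L] {n : ℕ}
    {H : MvPolynomial (Fin 2) L} (hH : H.IsHomogeneous n) (h0 : H ≠ 0) :
    ∃ (c : L) (s : Multiset (L × L)), c ≠ 0 ∧ s.card = n ∧ (∀ q ∈ s, q ≠ 0) ∧
      H = C c * (s.map binaryLinearForm).prod := by
  have key := Polynomial.homogenize_eq_of_isHomogeneous hH rfl
  have hd : (aeval ![Polynomial.X, 1] H : Polynomial L).natDegree ≤ n := by
    rw [aeval_def, eval₂_eq']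
    refine Polynomial.natDegree_sum_le_of_forall_le _ _ fun m hm => ?_
    refine (Polynomial.natDegree_C_mul_le _ _).trans ?_
    obtain rfl : m.weight 1 = n := hH (by simpa using hm)
    simp [Finsupp.weight_apply, Finsupp.sum_fintype, Fin.prod_univ_two, Fin.sum_univ_two]
  obtain ⟨c, s, h⟩ := exists_homogenize_eq_prod n _
    (by intro h; rw [h] at key; simp at key; exact h0 key.symm) hd
  rw [key] at h
  exact ⟨c, s, h⟩

/-! ### Applying a linear functional to the coefficients -/

/-- The result of applying a linear map to each coefficient of a polynomial. -/
noncomputable def mapCoeffs {σ K L : Type*} [Field K] [Field L] [Algebra K L] (ρ : L →ₗ[K] K)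
    (G : MvPolynomial σ L) : MvPolynomial σ K :=
  ∑ m ∈ G.support, monomial m (ρ (G.coeff m))

theorem coeff_mapCoeffs {σ K L : Type*} [Field K] [Field L] [Algebra K L] (ρ : L →ₗ[K] K)
    (G : MvPolynomial σ L) (m : σ →₀ ℕ) : (mapCoeffs ρ G).coeff m = ρ (G.coeff m) := by
  classical
  simp only [mapCoeffs, coeff_sum, coeff_monomial, Finset.sum_ite_eq', mem_support_iff]
  split_ifs with h
  · rfl
  · simp [not_not.1 h]

/-- Linearity over `K[x]`: divisibility by a polynomial over `K` descends from `L[x]` to `K[x]`. -/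
theorem mapCoeffs_map_mul {σ K L : Type*} [Field K] [Field L] [Algebra K L] (ρ : L →ₗ[K] K)
    (g : MvPolynomial σ K) (G : MvPolynomial σ L) :
    mapCoeffs ρ (map (algebraMap K L) g * G) = g * mapCoeffs ρ G := by
  classical
  ext m
  simp only [coeff_mapCoeffs, coeff_mul, map_sum, coeff_map, ← Algebra.smul_def, map_smul,
    smul_eq_mul]

theorem mapCoeffs_C_mul_map {σ K L : Type*} [Field K] [Field L] [Algebra K L] (ρ : L →ₗ[K] K)
    (a : L) (g : MvPolynomial σ K) :
    mapCoeffs ρ (C a * map (algebraMap K L) g) = C (ρ a) * g := by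
  ext m
  rw [coeff_mapCoeffs, coeff_C_mul, coeff_map, mul_comm, ← Algebra.smul_def, map_smul, coeff_C_mul,
    smul_eq_mul, mul_comm]

theorem mapCoeffs_add {σ K L : Type*} [Field K] [Field L] [Algebra K L] (ρ : L →ₗ[K] K)
    (G G' : MvPolynomial σ L) : mapCoeffs ρ (G + G') = mapCoeffs ρ G + mapCoeffs ρ G' := by
  ext m
  simp [coeff_mapCoeffs]

theorem exists_linear_dual_of_notMem_range {K L : Type*} [Field K] [Field L] [Algebra K L] {t : L}
    (ht : t ∉ Set.range (algebraMap K L)) (a b : K) :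
    ∃ ρ : L →ₗ[K] K, ρ 1 = a ∧ ρ t = b := by
  have hli : LinearIndependent K ![1, t] := by
    rw [LinearIndependent.pair_iff' one_ne_zero]
    intro r hr
    exact ht ⟨r, by rw [← hr, Algebra.smul_def, mul_one]⟩
  obtain ⟨f, hf⟩ := LinearMap.exists_leftInverse_of_injective (Finsupp.linearCombination K ![1, t])
    (LinearMap.ker_eq_bot.2 hli)
  refine ⟨Finsupp.linearCombination K ![a, b] ∘ₗ f, ?_, ?_⟩
  · have := LinearMap.congr_fun hf (Finsupp.single 0 1)
    simp at this
    simp [this]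
  · have := LinearMap.congr_fun hf (Finsupp.single 1 1)
    simp at this
    simp [this]

/-! ### Members of the pencil spanned by two polynomials -/

/-- The member `p.1 φ + p.2 ψ` of the pencil spanned by `φ` and `ψ`, over an extension field. -/
noncomputable def pencil {σ K L : Type*} [Field K] [Field L] [Algebra K L]
    (φ ψ : MvPolynomial σ K) (p : L × L) : MvPolynomial σ L :=
  C p.1 * map (algebraMap K L) φ + C p.2 * map (algebraMap K L) ψ

section Pencil

variable {σ K L : Type*} [Field K] [Field L] [Algebra K L]

theorem aeval_binaryLinearForm (φ ψ : MvPolynomial σ K) (p : L × L) :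
    aeval ![map (algebraMap K L) φ, map (algebraMap K L) ψ] (binaryLinearForm p) =
      pencil φ ψ p := by
  simp [binaryLinearForm, pencil, algebraMap_eq]

theorem pencil_smul_algebraMap (φ ψ : MvPolynomial σ K) (γ : L) (a b : K) :
    pencil φ ψ (γ * algebraMap K L a, γ * algebraMap K L b) =
      C γ * map (algebraMap K L) (C a * φ + C b * ψ) := by
  simp [pencil]
  ring

theorem transcendental_of_notMem_range [IsAlgClosed K] {t : L}
    (ht : t ∉ Set.range (algebraMap K L)) :
    Transcendental K t := by
  intro h
  apply ht
  have hi := h.isIntegral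
  exact minpoly.mem_range_of_degree_eq_one K t
    (IsAlgClosed.degree_eq_one_of_irreducible K (minpoly.irreducible hi))

/-- Since `t` is transcendental, `X ↦ t` embeds `K(X)` in `L`, and the embedding extends to the
algebraic closure. -/
theorem exists_ringHom_of_notMem_range [IsAlgClosed K] [IsAlgClosed L] {t : L}
    (ht : t ∉ Set.range (algebraMap K L)) :
    ∃ i : AlgebraicClosure (RatFunc K) →+* L,
      i.comp (algebraMap K (AlgebraicClosure (RatFunc K))) = algebraMap K L ∧
      i (algebraMap (RatFunc K) (AlgebraicClosure (RatFunc K)) RatFunc.X) = t := by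
  have htr := transcendental_of_notMem_range ht
  have hinj : Function.Injective (Polynomial.aeval (R := K) t) :=
    transcendental_iff_injective.1 htr
  let j : RatFunc K →+* L := RatFunc.liftRingHom (Polynomial.aeval (R := K) t).toRingHom
    (nonZeroDivisors_le_comap_nonZeroDivisors_of_injective _ hinj)
  let _ : Algebra (RatFunc K) L := j.toAlgebra
  let i : AlgebraicClosure (RatFunc K) →ₐ[RatFunc K] L := IsAlgClosed.lift
  refine ⟨i.toRingHom, ?_, ?_⟩
  · ext x
    have h1 : algebraMap K (AlgebraicClosure (RatFunc K)) x =
        algebraMap (RatFunc K) _ (RatFunc.C x) := by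
      rw [IsScalarTower.algebraMap_apply K (RatFunc K) (AlgebraicClosure (RatFunc K))]
      rfl
    rw [RingHom.comp_apply, h1]
    refine (i.commutes _).trans ?_
    refine (RatFunc.liftRingHom_C _ _ x).trans ?_
    simp
  · refine (i.commutes _).trans ?_
    refine (RatFunc.liftRingHom_X _ _).trans ?_
    simp

theorem exists_algebraMap_or_notMem_range {p : L × L} (hp : p ≠ 0) :
    (∃ (γ : L) (a b : K), γ ≠ 0 ∧ (a, b) ≠ (0, 0) ∧
      p = (γ * algebraMap K L a, γ * algebraMap K L b)) ∨
    (p.1 ≠ 0 ∧ p.2 / p.1 ∉ Set.range (algebraMap K L)) := by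
  obtain ⟨x, y⟩ := p
  by_cases hx : x = 0
  · subst hx
    exact .inl ⟨y, 0, 1, by rintro rfl; exact hp rfl, by simp, by simp⟩
  · by_cases h : y / x ∈ Set.range (algebraMap K L)
    · obtain ⟨b, hb⟩ := h
      refine .inl ⟨x, 1, b, hx, by simp, ?_⟩
      rw [hb]
      simp [mul_div_cancel₀ _ hx]
    · exact .inr ⟨hx, h⟩

theorem pencil_eq_C_mul {φ ψ : MvPolynomial σ K} {p : L × L} (h1 : p.1 ≠ 0) :
    pencil φ ψ p = C p.1 * (map (algebraMap K L) φ + C (p.2 / p.1) * map (algebraMap K L) ψ) := by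
  rw [mul_add, ← mul_assoc, ← C_mul, mul_div_cancel₀ _ h1, pencil]

theorem isUnit_C_of_ne_zero {a : L} (ha : a ≠ 0) : IsUnit (C a : MvPolynomial σ L) :=
  (isUnit_iff_ne_zero.2 ha).map C

/-- The pencil spanned by `φ` and `ψ` has an irreducible generic member. -/
def GenericallyIrreducible (φ ψ : MvPolynomial σ K) : Prop :=
  Irreducible
    (map (algebraMap K (AlgebraicClosure (RatFunc K))) φ +
      C (algebraMap (RatFunc K) (AlgebraicClosure (RatFunc K)) RatFunc.X) *
        map (algebraMap K (AlgebraicClosure (RatFunc K))) ψ)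

theorem GenericallyIrreducible.irreducible_pencil [IsAlgClosed K] [IsAlgClosed L]
    {φ ψ : MvPolynomial σ K}
    (hirr : GenericallyIrreducible φ ψ) {p : L × L} (h1 : p.1 ≠ 0)
    (h2 : p.2 / p.1 ∉ Set.range (algebraMap K L)) : Irreducible (pencil φ ψ p) := by
  obtain ⟨i, hi, hX⟩ := exists_ringHom_of_notMem_range h2
  let _ : Algebra (AlgebraicClosure (RatFunc K)) L := i.toAlgebra
  have h := irreducible_map_of_isAlgClosed (L := L) hirr
  have hi' : algebraMap (AlgebraicClosure (RatFunc K)) L = i := rfl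
  rw [hi', map_add, map_mul, map_map, map_map, hi, map_C, hX] at h
  rw [pencil_eq_C_mul h1]
  exact (irreducible_isUnit_mul (isUnit_C_of_ne_zero h1)).2 h

/-- A nontrivial relation between coprime polynomials forces both to be constant, and then the
generic member is constant too. -/
theorem GenericallyIrreducible.eq_zero_of_linear_relation {φ ψ : MvPolynomial σ K}
    (hirr : GenericallyIrreducible φ ψ) (hrel : IsRelPrime φ ψ) {a b : K}
    (h : C a * φ + C b * ψ = 0) : (a, b) = (0, 0) := by
  by_contra hab
  have hconst : ∃ x y : K, φ = C x ∧ ψ = C y := by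
    by_cases hb : b = 0
    · have ha : a ≠ 0 := by rintro rfl; exact hab (by rw [hb])
      have hφ : φ = 0 := by simpa [hb, ha] using h
      have hu : IsUnit ψ := hrel (hφ ▸ dvd_zero ψ) dvd_rfl
      obtain ⟨y, -, hy⟩ := isUnit_iff_eq_C_of_isReduced.1 hu
      exact ⟨0, y, by simp [hφ], hy⟩
    · have hψ : ψ = C (-a / b) * φ := by
        apply (isUnit_C_of_ne_zero (σ := σ) hb).mul_left_cancel
        rw [← mul_assoc, ← C_mul, mul_div_cancel₀ _ hb, eq_neg_of_add_eq_zero_right h]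
        simp
      have hu : IsUnit φ := hrel dvd_rfl (hψ ▸ dvd_mul_left _ _)
      obtain ⟨x, -, hx⟩ := isUnit_iff_eq_C_of_isReduced.1 hu
      exact ⟨x, -a / b * x, hx, by rw [hψ, hx, C_mul]⟩
  obtain ⟨x, y, rfl, rfl⟩ := hconst
  have := hirr
  rw [GenericallyIrreducible, map_C, map_C, ← C_mul, ← C_add] at this
  refine this.not_isUnit (isUnit_C_of_ne_zero ?_)
  intro h0
  rw [h0, C_0] at this
  exact this.ne_zero rfl

theorem GenericallyIrreducible.pencil_ne_zero [IsAlgClosed K] [IsAlgClosed L]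
    {φ ψ : MvPolynomial σ K}
    (hirr : GenericallyIrreducible φ ψ) (hrel : IsRelPrime φ ψ) {p : L × L} (hp : p ≠ 0) :
    pencil φ ψ p ≠ 0 := by
  rcases exists_algebraMap_or_notMem_range (K := K) hp with ⟨γ, a, b, hγ, hab, rfl⟩ | ⟨h1, h2⟩
  · rw [pencil_smul_algebraMap]
    intro h0
    rw [(isUnit_C_of_ne_zero hγ).mul_right_eq_zero,
      map_eq_zero_iff _ (map_injective _ (algebraMap K L).injective)] at h0
    exact hab (hirr.eq_zero_of_linear_relation hrel h0)
  · exact (hirr.irreducible_pencil h1 h2).ne_zero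

theorem GenericallyIrreducible.eq_zero_of_aeval_eq_zero [IsAlgClosed K] [IsAlgClosed L]
    {φ ψ : MvPolynomial σ K}
    (hirr : GenericallyIrreducible φ ψ) (hrel : IsRelPrime φ ψ) {d : ℕ}
    {H : MvPolynomial (Fin 2) L} (hH : H.IsHomogeneous d)
    (h : aeval ![map (algebraMap K L) φ, map (algebraMap K L) ψ] H = 0) : H = 0 := by
  by_contra h0
  obtain ⟨c, s, hc, -, hs, rfl⟩ := exists_eq_prod_of_isHomogeneous hH h0
  rw [map_mul, algHom_C, algebraMap_eq, (isUnit_C_of_ne_zero hc).mul_right_eq_zero,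
    map_multiset_prod, Multiset.prod_eq_zero_iff, Multiset.map_map, Multiset.mem_map] at h
  obtain ⟨p, hp, hp0⟩ := h
  rw [Function.comp_apply, aeval_binaryLinearForm] at hp0
  exact hirr.pencil_ne_zero hrel (hs p hp) hp0

theorem aeval_C_mul_prod (φ ψ : MvPolynomial σ K) (c : L) (s : Multiset (L × L)) :
    aeval ![map (algebraMap K L) φ, map (algebraMap K L) ψ]
      (C c * (s.map binaryLinearForm).prod) = C c * (s.map (pencil φ ψ)).prod := by
  rw [map_mul, algHom_C, algebraMap_eq, map_multiset_prod, Multiset.map_map]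
  simp only [Function.comp_def, aeval_binaryLinearForm]

/-- A nonconstant member of the pencil dividing a polynomial without nonconstant divisors over `K`
is irreducible. -/
theorem ratio_notMem_range_of_dvd {F : MvPolynomial σ L}
    (hF : ∀ g : MvPolynomial σ K, map (algebraMap K L) g ∣ F → IsUnit g)
    {φ ψ : MvPolynomial σ K} {p : L × L} (hp : p ≠ 0) (hdvd : pencil φ ψ p ∣ F)
    (hu : ¬ IsUnit (pencil φ ψ p)) :
    p.1 ≠ 0 ∧ p.2 / p.1 ∉ Set.range (algebraMap K L) := by
  rcases exists_algebraMap_or_notMem_range (K := K) hp with ⟨γ, a, b, hγ, hab, rfl⟩ | h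
  · rw [pencil_smul_algebraMap] at hdvd hu
    exact absurd ((isUnit_C_of_ne_zero hγ).mul
      ((hF _ (dvd_of_mul_left_dvd hdvd)).map (map (algebraMap K L)))) hu
  · exact h

theorem exists_linear_combination_of_pencil_eq {φ₁ ψ₁ φ₂ ψ₂ : MvPolynomial σ K} {p q : L × L}
    {e : L} (h1 : p.1 ≠ 0) (h2 : p.2 / p.1 ∉ Set.range (algebraMap K L))
    (h : pencil φ₁ ψ₁ p = C e * pencil φ₂ ψ₂ q) :
    ∃ a b c d : K, φ₁ = C a * φ₂ + C b * ψ₂ ∧ ψ₁ = C c * φ₂ + C d * ψ₂ := by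
  have h' : C 1 * map (algebraMap K L) φ₁ + C (p.2 / p.1) * map (algebraMap K L) ψ₁ =
      C (p.1⁻¹ * e * q.1) * map (algebraMap K L) φ₂ +
        C (p.1⁻¹ * e * q.2) * map (algebraMap K L) ψ₂ := by
    rw [pencil_eq_C_mul h1] at h
    apply (isUnit_C_of_ne_zero (σ := σ) h1).mul_left_cancel
    rw [C_1, one_mul, h, pencil]
    have : (C p.1 * C p.1⁻¹ : MvPolynomial σ L) = 1 := by
      rw [← C_mul, mul_inv_cancel₀ h1, C_1]
    simp only [C_mul]
    linear_combination (-C e * (C q.1 * map (algebraMap K L) φ₂ +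
      C q.2 * map (algebraMap K L) ψ₂)) * this
  have key : ∀ ρ : L →ₗ[K] K, C (ρ 1) * φ₁ + C (ρ (p.2 / p.1)) * ψ₁ =
      C (ρ (p.1⁻¹ * e * q.1)) * φ₂ + C (ρ (p.1⁻¹ * e * q.2)) * ψ₂ := by
    intro ρ
    have := congrArg (mapCoeffs ρ) h'
    simpa only [mapCoeffs_add, mapCoeffs_C_mul_map] using this
  -- `ρ` isolates `φ₁` and `τ` isolates `ψ₁`.
  obtain ⟨ρ, hρ1, hρt⟩ := exists_linear_dual_of_notMem_range h2 1 0
  obtain ⟨τ, hτ1, hτt⟩ := exists_linear_dual_of_notMem_range h2 0 1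
  have hρ := key ρ
  have hτ := key τ
  rw [hρ1, hρt, C_1, C_0, one_mul, zero_mul, add_zero] at hρ
  rw [hτ1, hτt, C_1, C_0, one_mul, zero_mul, zero_add] at hτ
  exact ⟨_, _, _, _, hρ, hτ⟩

theorem GenericallyIrreducible.exists_linear_combination [IsAlgClosed K] [IsAlgClosed L]
    {F : MvPolynomial σ L} (hF0 : F ≠ 0) (hFu : ¬ IsUnit F)
    (hF : ∀ g : MvPolynomial σ K, map (algebraMap K L) g ∣ F → IsUnit g)
    {φ₁ ψ₁ φ₂ ψ₂ : MvPolynomial σ K} (hirr₁ : GenericallyIrreducible φ₁ ψ₁)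
    (hirr₂ : GenericallyIrreducible φ₂ ψ₂) {H₁ H₂ : MvPolynomial (Fin 2) L} {d₁ d₂ : ℕ}
    (hH₁ : H₁.IsHomogeneous d₁) (hH₂ : H₂.IsHomogeneous d₂)
    (h₁ : F = aeval ![map (algebraMap K L) φ₁, map (algebraMap K L) ψ₁] H₁)
    (h₂ : F = aeval ![map (algebraMap K L) φ₂, map (algebraMap K L) ψ₂] H₂) :
    ∃ a b c d : K, φ₁ = C a * φ₂ + C b * ψ₂ ∧ ψ₁ = C c * φ₂ + C d * ψ₂ := by
  obtain ⟨c₁, s₁, hc₁, -, hs₁, rfl⟩ := exists_eq_prod_of_isHomogeneous hH₁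
    (by rintro rfl; exact hF0 (by simpa using h₁))
  obtain ⟨c₂, s₂, hc₂, -, hs₂, rfl⟩ := exists_eq_prod_of_isHomogeneous hH₂
    (by rintro rfl; exact hF0 (by simpa using h₂))
  rw [aeval_C_mul_prod] at h₁ h₂
  -- Decompositions need not be reduced here, so some factors may be constant, but not all.
  have hex : ∃ p ∈ s₁, ¬ IsUnit (pencil φ₁ ψ₁ p) := by
    by_contra! hall
    apply hFu
    rw [h₁]
    refine (isUnit_C_of_ne_zero hc₁).mul (Multiset.prod_induction IsUnit _ (fun _ _ => IsUnit.mul)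
      isUnit_one ?_)
    intro x hx
    obtain ⟨p, hp, rfl⟩ := Multiset.mem_map.1 hx
    exact hall p hp
  obtain ⟨p, hp, hpu⟩ := hex
  have hpF : pencil φ₁ ψ₁ p ∣ F :=
    h₁ ▸ (Multiset.dvd_prod (Multiset.mem_map_of_mem _ hp)).mul_left _
  obtain ⟨hp1, hp2⟩ := ratio_notMem_range_of_dvd hF (hs₁ p hp) hpF hpu
  have hprime := (hirr₁.irreducible_pencil hp1 hp2).prime
  have hdvd : pencil φ₁ ψ₁ p ∣ (s₂.map (pencil φ₂ ψ₂)).prod := by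
    rw [h₂] at hpF
    exact ((isUnit_C_of_ne_zero hc₂).dvd_mul_left).1 hpF
  obtain ⟨q, hq, hpq⟩ := hprime.exists_mem_multiset_map_dvd hdvd
  have hqF : pencil φ₂ ψ₂ q ∣ F :=
    h₂ ▸ (Multiset.dvd_prod (Multiset.mem_map_of_mem _ hq)).mul_left _
  obtain ⟨hq1, hq2⟩ := ratio_notMem_range_of_dvd hF (hs₂ q hq) hqF
    fun hu => hprime.not_isUnit (isUnit_of_dvd_unit hpq hu)
  obtain ⟨u, hu⟩ := hprime.irreducible.associated_of_dvd (hirr₂.irreducible_pencil hq1 hq2) hpq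
  obtain ⟨e, -, he⟩ := isUnit_iff_eq_C_of_isReduced.1 (u⁻¹).isUnit
  refine exists_linear_combination_of_pencil_eq (e := e) hp1 hp2 (q := q) ?_
  rw [← hu, ← he, mul_comm, mul_assoc, Units.mul_inv, mul_one]

/-- If no member of the pencil over `K` whose linear form divides `H` is constant, the degree of `H`
is the number of irreducible factors of `H(φ, ψ)`. -/
theorem GenericallyIrreducible.exists_irreducible_factors [IsAlgClosed K] [IsAlgClosed L]
    {F : MvPolynomial σ L} (hF0 : F ≠ 0)
    (hF : ∀ g : MvPolynomial σ K, map (algebraMap K L) g ∣ F → IsUnit g)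
    {φ ψ : MvPolynomial σ K} (hirr : GenericallyIrreducible φ ψ)
    {H : MvPolynomial (Fin 2) L} {d : ℕ} (hH : H.IsHomogeneous d)
    (h : F = aeval ![map (algebraMap K L) φ, map (algebraMap K L) ψ] H)
    (hred : ∀ α β : K, (α, β) ≠ (0, 0) →
      C (algebraMap K L α) * X 0 + C (algebraMap K L β) * X 1 ∣ H →
      ¬ ∃ c : K, C α * φ + C β * ψ = C c) :
    ∃ m : Multiset (MvPolynomial σ L), (∀ f ∈ m, Irreducible f) ∧ m.card = d ∧
      Associated m.prod F := by
  obtain ⟨c, s, hc, hcard, hs, rfl⟩ := exists_eq_prod_of_isHomogeneous hH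
    (by rintro rfl; exact hF0 (by simpa using h))
  rw [aeval_C_mul_prod] at h
  refine ⟨s.map (pencil φ ψ), ?_, by simpa using hcard, ?_⟩
  · intro f hf
    obtain ⟨p, hp, rfl⟩ := Multiset.mem_map.1 hf
    rcases exists_algebraMap_or_notMem_range (K := K) (hs p hp) with
      ⟨γ, a, b, hγ, hab, rfl⟩ | ⟨h1, h2⟩
    · exfalso
      have hdvd : pencil φ ψ (γ * algebraMap K L a, γ * algebraMap K L b) ∣ F :=
        h ▸ (Multiset.dvd_prod (Multiset.mem_map_of_mem _ hp)).mul_left _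
      rw [pencil_smul_algebraMap] at hdvd
      obtain ⟨x, -, hx⟩ := isUnit_iff_eq_C_of_isReduced.1 (hF _ (dvd_of_mul_left_dvd hdvd))
      refine hred a b hab (Dvd.dvd.mul_left ?_ _) ⟨x, hx⟩
      refine Dvd.dvd.trans ⟨C γ, ?_⟩
        (Multiset.dvd_prod (Multiset.mem_map_of_mem binaryLinearForm hp))
      simp [binaryLinearForm]
      ring
    · exact hirr.irreducible_pencil h1 h2
  · rw [h]
    exact (associated_isUnit_mul_right_iff (isUnit_C_of_ne_zero hc)).2 (Associated.refl _)

end Pencil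

theorem isHomogeneous_aeval_linear {L : Type*} [Field L] {d : ℕ} {H : MvPolynomial (Fin 2) L}
    (hH : H.IsHomogeneous d) (a b c e : L) :
    (aeval ![C a * X 0 + C b * X 1, C c * X 0 + C e * X 1] H :
      MvPolynomial (Fin 2) L).IsHomogeneous d := by
  have key : ∀ x y : L, (C x * X 0 + C y * X 1 : MvPolynomial (Fin 2) L).IsHomogeneous 1 :=
    fun x y => (isHomogeneous_C_mul_X x 0).add (isHomogeneous_C_mul_X y 1)
  have := hH.aeval ![C a * X 0 + C b * X 1, C c * X 0 + C e * X 1] (n := 1)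
    (Fin.forall_fin_two.2 ⟨key a b, key c e⟩)
  rwa [one_mul] at this

theorem algebraMap_paramClosure_injective (K : Type*) [Field K] (ℓ : ℕ) :
    Function.Injective (algebraMap (MvPolynomial (Fin ℓ) K) (ParamClosure K ℓ)) := by
  rw [IsScalarTower.algebraMap_eq _ (ParamField K ℓ)]
  exact (algebraMap (ParamField K ℓ) _).injective.comp (IsFractionRing.injective _ _)

/-! ### Coprimality of the coefficients of the generic form -/

/-- The generic form has no nonconstant divisor over the ground field. -/
theorem isUnit_of_map_dvd_genericForm {K : Type*} [Field K] {n ℓ : ℕ}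
    {P : MvPolynomial (Fin n) K} {Q : Fin ℓ → MvPolynomial (Fin n) K}
    (hprime : ∀ a : MvPolynomial (Fin n) K, a ∣ P → (∀ i, a ∣ Q i) → IsUnit a)
    {g : MvPolynomial (Fin n) K}
    (hg : map (algebraMap K (ParamClosure K ℓ)) g ∣
      map (algebraMap (MvPolynomial (Fin ℓ) K) (ParamClosure K ℓ)) (genericForm P Q)) :
    IsUnit g := by
  classical
  obtain ⟨G, hG⟩ := hg
  let j : MvPolynomial (Fin ℓ) K →ₐ[K] ParamClosure K ℓ :=
    IsScalarTower.toAlgHom K (MvPolynomial (Fin ℓ) K) (ParamClosure K ℓ)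
  have hj : Function.Injective j :=
    algebraMap_paramClosure_injective K ℓ
  -- A `K`-linear retraction of `L` onto `K[λ]`; following it by a coefficient of `λ^m` extracts `P`
  -- (`m = 0`) and `Q i` (`m` the exponent of `λ_i`) from `F`.
  obtain ⟨r, hr⟩ := LinearMap.exists_leftInverse_of_injective j.toLinearMap
    (LinearMap.ker_eq_bot.2 hj)
  have hr' : ∀ x, r (algebraMap (MvPolynomial (Fin ℓ) K) (ParamClosure K ℓ) x) = x :=
    fun x => LinearMap.congr_fun hr x
  have hF : map (algebraMap (MvPolynomial (Fin ℓ) K) (ParamClosure K ℓ)) (genericForm P Q) =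
      C (algebraMap (MvPolynomial (Fin ℓ) K) (ParamClosure K ℓ) 1) *
          map (algebraMap K (ParamClosure K ℓ)) P +
        ∑ i, C (algebraMap (MvPolynomial (Fin ℓ) K) (ParamClosure K ℓ) (X i)) *
          map (algebraMap K (ParamClosure K ℓ)) (Q i) := by
    have hc : (algebraMap (MvPolynomial (Fin ℓ) K) (ParamClosure K ℓ)).comp C =
        algebraMap K (ParamClosure K ℓ) :=
      (IsScalarTower.algebraMap_eq K (MvPolynomial (Fin ℓ) K) (ParamClosure K ℓ)).symm
    simp [genericForm, map_map, hc]
  have key : ∀ m : Fin ℓ →₀ ℕ,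
      g ∣ C (coeff m (1 : MvPolynomial (Fin ℓ) K)) * P +
        ∑ i, C (coeff m (X i : MvPolynomial (Fin ℓ) K)) * Q i := by
    intro m
    refine ⟨mapCoeffs ((lcoeff K m).comp r) G, ?_⟩
    rw [← mapCoeffs_map_mul, ← hG, hF]
    ext k
    simp only [coeff_mapCoeffs, coeff_add, coeff_C_mul, coeff_sum, coeff_map, map_add, map_sum]
    simp only [mul_comm _ (algebraMap K (ParamClosure K ℓ) _), ← Algebra.smul_def, map_smul,
      LinearMap.comp_apply, hr', lcoeff_apply, smul_eq_mul]
    simp only [mul_comm]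
  refine hprime g ?_ fun i => ?_
  · simpa [coeff_one, coeff_zero_X] using key 0
  · simpa [coeff_X, coeff_one, Finsupp.single_left_inj, eq_comm] using key (Finsupp.single i 1)

theorem theorem2p5 {K : Type*} [Field K] [IsAlgClosed K] (n ℓ : ℕ) (hn : 2 ≤ n) (hℓ : 1 ≤ ℓ)
    (P : MvPolynomial (Fin n) K) (Q : Fin ℓ → MvPolynomial (Fin n) K)
    -- `P, Q₁, …, Q_ℓ` are non-zero, not all constant, and pairwise distinct up to
    -- multiplicative constants
    (hP : P ≠ 0) (hQ : ∀ i, Q i ≠ 0)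
    (hdeg : 0 < P.totalDegree ∨ ∃ i, 0 < (Q i).totalDegree)
    (hPQ : ∀ i, ∀ c : K, Q i ≠ C c * P)
    (hQQ : ∀ i j, i ≠ j → ∀ c : K, Q i ≠ C c * Q j)
    -- `P, Q₁, …, Q_ℓ` (together) are relatively prime
    (hprime : ∀ a : MvPolynomial (Fin n) K, a ∣ P → (∀ i, a ∣ Q i) → IsUnit a)
    (φ₁ ψ₁ φ₂ ψ₂ : MvPolynomial (Fin n) K)
    (H₁ H₂ : MvPolynomial (Fin 2) (ParamClosure K ℓ))
    (h₁ : IsMaximalDecomposition (genericForm P Q) φ₁ ψ₁ H₁)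
    (h₂ : IsMaximalDecomposition (genericForm P Q) φ₂ ψ₂ H₂) :
    ∃ L : GL (Fin 2) K,
      (φ₁ = C (L.val 0 0) * φ₂ + C (L.val 0 1) * ψ₂ ∧
        ψ₁ = C (L.val 1 0) * φ₂ + C (L.val 1 1) * ψ₂) ∧
      (IsReducedDecomposition φ₁ ψ₁ H₁ → IsReducedDecomposition φ₂ ψ₂ H₂ →
        ∃ c : K, c ≠ 0 ∧
          C (algebraMap K (ParamClosure K ℓ) c) * H₂ =
            aeval ![C (algebraMap K (ParamClosure K ℓ) (L.val 0 0)) * X 0 +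
                      C (algebraMap K (ParamClosure K ℓ) (L.val 0 1)) * X 1,
                    C (algebraMap K (ParamClosure K ℓ) (L.val 1 0)) * X 0 +
                      C (algebraMap K (ParamClosure K ℓ) (L.val 1 1)) * X 1] H₁) := by
  obtain ⟨⟨hrel₁, hdeg₁, ⟨d₁, hH₁⟩, hF₁⟩, hirr₁⟩ := h₁
  obtain ⟨⟨hrel₂, -, ⟨d₂, hH₂⟩, hF₂⟩, hirr₂⟩ := h₂
  change GenericallyIrreducible φ₁ ψ₁ at hirr₁
  change GenericallyIrreducible φ₂ ψ₂ at hirr₂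
  have hinj := algebraMap_paramClosure_injective K ℓ
  set F := map (algebraMap (MvPolynomial (Fin ℓ) K) (ParamClosure K ℓ)) (genericForm P Q) with hFdef
  have hFdeg : F.totalDegree ≠ 0 := by
    rw [hFdef, totalDegree, support_map_of_injective _ hinj, ← totalDegree]
    omega
  have hF0 : F ≠ 0 := by
    intro h
    simp [h] at hFdeg
  have hFu : ¬ IsUnit F := fun h => hFdeg (isUnit_iff_totalDegree_of_isReduced.1 h).2
  have hF : ∀ g : MvPolynomial (Fin n) K, map (algebraMap K (ParamClosure K ℓ)) g ∣ F → IsUnit g :=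
    fun g hg => isUnit_of_map_dvd_genericForm hprime hg
  obtain ⟨a, b, c, d, hφ, hψ⟩ :=
    hirr₁.exists_linear_combination hF0 hFu hF hirr₂ hH₁ hH₂ hF₁ hF₂
  have hdet : (!![a, b; c, d] : Matrix (Fin 2) (Fin 2) K).det ≠ 0 := by
    intro h0
    -- A left kernel vector would be a linear relation between `φ₁` and `ψ₁`.
    obtain ⟨v, hv, hv0⟩ := Matrix.exists_vecMul_eq_zero_iff.2 h0
    have e0 : v 0 * a + v 1 * c = 0 := by
      simpa [Matrix.vecMul, dotProduct, Fin.sum_univ_two] using congrFun hv0 0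
    have e1 : v 0 * b + v 1 * d = 0 := by
      simpa [Matrix.vecMul, dotProduct, Fin.sum_univ_two] using congrFun hv0 1
    have hlin : C (v 0) * φ₁ + C (v 1) * ψ₁ = 0 := by
      have e0' := congrArg (C (σ := Fin n)) e0
      have e1' := congrArg (C (σ := Fin n)) e1
      simp only [C_add, C_mul, C_0] at e0' e1'
      rw [hφ, hψ]
      linear_combination φ₂ * e0' + ψ₂ * e1'
    have hv' := hirr₁.eq_zero_of_linear_relation hrel₁ hlin
    rw [Prod.mk.injEq] at hv'
    apply hv
    ext i
    fin_cases i
    exacts [hv'.1, hv'.2]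
  refine ⟨Matrix.GeneralLinearGroup.mkOfDetNeZero !![a, b; c, d] hdet, ⟨hφ, hψ⟩, ?_⟩
  intro hred₁ hred₂
  obtain ⟨m₁, hm₁, hcard₁, hprod₁⟩ := hirr₁.exists_irreducible_factors hF0 hF hH₁ hF₁ hred₁
  obtain ⟨m₂, hm₂, hcard₂, hprod₂⟩ := hirr₂.exists_irreducible_factors hF0 hF hH₂ hF₂ hred₂
  have hd : d₁ = d₂ := by
    rw [← hcard₁, ← hcard₂]
    exact Multiset.card_eq_card_of_rel
      (UniqueFactorizationMonoid.factors_unique hm₁ hm₂ (hprod₁.trans hprod₂.symm))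
  subst hd
  -- The constant is exactly 1: both forms take the value `F` at `(φ₂, ψ₂)`.
  refine ⟨1, one_ne_zero, ?_⟩
  rw [map_one, C_1, one_mul, ← sub_eq_zero]
  refine hirr₂.eq_zero_of_aeval_eq_zero hrel₂
    (hH₂.sub (isHomogeneous_aeval_linear hH₁ _ _ _ _)) ?_
  rw [map_sub, ← hF₂, hF₁, sub_eq_zero, ← AlgHom.comp_apply]
  congr 1
  ext i
  fin_cases i <;> simp [hφ, hψ, algebraMap_eq]
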